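/- For a finite set $S\subseteq\{0,1,\dots,n\}$ of integers let $\lambda_n(S)=(2n+1-|S+S|,\;2n+1-|S-S|)$ be the pair consisting of the number of missing sums and the number of missing differences of $S$, where $S\pm S=\{a\pm b: a,b\in S\}\subseteq\mathbb{Z}$. Let $\Lambda\subseteq\mathbb{Z}_{\ge 0}\times\mathbb{Z}_{\ge 0}$ contain at least one pair $(s,d)$ with $d$ even. For each $n\ge 0$ let $S_n$ be a uniformly random subset of $\{0,1,\dots,n\}$. Then, for every real number $t$, $$\lim_{n\to\infty}\mathbb{P}\left(|S_n|<\frac{n+t\sqrt n}{2}\;\middle|\;\lambda_n(S_n)\in\Lambda\right)=\Phi(t),$$ where $\Phi(t)=\frac{1}{\sqrt{2\pi}}\int_{-\infty}^{t}e^{-x^2/2}\,dx$ is the standard normal distribution function. (The conditioning event may have probability $0$ for finitely many $n$; these $n$ are irrelevant for the limit.) -/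

import Mathlib

open MeasureTheory ProbabilityTheory Filter Topology
open scoped Pointwise

/-- The collection of all subsets of the integer interval `[0, n] = {0, 1, …, n}`. -/
def intervalSubsets (n : ℕ) : Set (Finset ℤ) := {S | S ⊆ Finset.Icc 0 (n : ℤ)}

/-- `λ_n(S) = (2n + 1 - |S + S|, 2n + 1 - |S - S|)`: the number of missing sums and the number of
missing differences of `S ⊆ {0, 1, …, n}`. Here `S - S` is formed in `ℤ`. For `S ⊆ {0, …, n}` the
subtractions do not truncate, see `missingCount_fst_add` and `missingCount_snd_add`. -/
def missingCount (n : ℕ) (S : Finset ℤ) : ℕ × ℕ :=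
  (2 * n + 1 - (S + S).card, 2 * n + 1 - (S - S).card)

theorem missingCount_fst_add {n : ℕ} {S : Finset ℤ} (hS : S ∈ intervalSubsets n) :
    (missingCount n S).1 + (S + S).card = 2 * n + 1 := by
  have h : S + S ⊆ Finset.Icc 0 (2 * n : ℤ) := by
    intro x hx
    obtain ⟨a, ha, b, hb, rfl⟩ := Finset.mem_add.1 hx
    have h1 := Finset.mem_Icc.1 (hS ha)
    have h2 := Finset.mem_Icc.1 (hS hb)
    exact Finset.mem_Icc.2 ⟨by omega, by omega⟩
  have h' := Finset.card_le_card h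
  rw [Int.card_Icc] at h'
  simp only [missingCount]
  omega

theorem missingCount_snd_add {n : ℕ} {S : Finset ℤ} (hS : S ∈ intervalSubsets n) :
    (missingCount n S).2 + (S - S).card = 2 * n + 1 := by
  have h : S - S ⊆ Finset.Icc (-n : ℤ) n := by
    intro x hx
    obtain ⟨a, ha, b, hb, rfl⟩ := Finset.mem_sub.1 hx
    have h1 := Finset.mem_Icc.1 (hS ha)
    have h2 := Finset.mem_Icc.1 (hS hb)
    exact Finset.mem_Icc.2 ⟨by omega, by omega⟩
  have h' := Finset.card_le_card h
  rw [Int.card_Icc] at h'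
  simp only [missingCount]
  omega

/-! Missing sums and differences are decided at the two ends of `[0, n]`, the size of `S` by the
bulk. A sum or difference at distance `y` from the extremes has about `y / 2` potential
representations by disjoint pairs, so it is missing with probability exponentially small in `y`.
Outside an event of probability at most `24 * (7 / 8) ^ K`, uniformly in `n`, the missing counts
therefore depend only on the `2 * K` outermost positions (`subsetProb_not_middleFull_le`,
`missingCount_eq_fringeCount`, `fringeCount_inter_fringe`). These positions shift the size by at
most `2 * K`, negligible against `√n`, so the conditioning event and the size are asymptotically
independent (`abs_subsetProb_and_sub_mul_le`), and the unconditioned size obeys the central limit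
theorem (`tendsto_subsetProb_card_lt`).

Passing to conditional probabilities needs the conditioning event to have probability bounded below.
One pair `(s, 2 * e)` in `Λ` suffices, realised by prescribing a fringe of fixed size
(`exists_pos_le_subsetProb_missingCount_eq`). If `A` and `B` describe the left and right ends, read
inwards, the missing sums are the gaps of `A + A` and `B + B`, and the missing differences are twice
the gaps of `A + B`. The numbers of gaps can be chosen freely (`exists_cofinite_missing`) because
two digit sets can each be a basis while their cross sums skip a digit. -/

/-! ### Cofinite sets with prescribed numbers of missing sums and cross sums -/

/-- The blow-up of a set of digits `D ⊆ {0, …, 7}` by the factor `2 * h + 1`, together with a full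
tail. -/
def blowUp (h : ℕ) (D : Set ℕ) : Set ℕ :=
  {y | ∃ a ∈ D, ∃ i ≤ h, y = (2 * h + 1) * a + i} ∪ Set.Ici (8 * (2 * h + 1))

/-- Quotient and remainder modulo `2 * h + 1` are treated separately: the quotient is a sum of two
digits, and a remainder at most `2 * h` is a sum of two numbers at most `h`. -/
theorem blowUp_add_self {h : ℕ} {D : Set ℕ} (h0 : 0 ∈ D)
    (hD : ∀ q < 8, ∃ a ∈ D, ∃ b ∈ D, a + b = q) : blowUp h D + blowUp h D = Set.univ := by
  refine Set.eq_univ_of_forall fun y => ?_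
  have hm : 0 < 2 * h + 1 := by omega
  rcases lt_or_ge y (8 * (2 * h + 1)) with hy | hy
  · obtain ⟨a, ha, b, hb, hab⟩ := hD (y / (2 * h + 1)) ((Nat.div_lt_iff_lt_mul hm).2 hy)
    have hr : y % (2 * h + 1) < 2 * h + 1 := Nat.mod_lt _ hm
    have hdm := Nat.div_add_mod y (2 * h + 1)
    refine Set.mem_add.2 ⟨(2 * h + 1) * a + min (y % (2 * h + 1)) h, Or.inl ⟨a, ha, _, by omega, rfl⟩,
      (2 * h + 1) * b + (y % (2 * h + 1) - min (y % (2 * h + 1)) h),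
      Or.inl ⟨b, hb, _, by omega, rfl⟩, ?_⟩
    rw [← hab, mul_add] at hdm
    omega
  · exact Set.mem_add.2 ⟨0, Or.inl ⟨0, h0, 0, by omega, by simp⟩, y, Or.inr hy, by simp⟩

/-- Remainders add up to at most `2 * h`, so there is no carry, and 7 is not in `{0, 1, 3, 4} + {0,
1, 2, 5}`. Yet each of these digit sets added to itself covers `0, …, 7`. -/
theorem notMem_blowUp_add {h y : ℕ} (h1 : 7 * (2 * h + 1) ≤ y) (h2 : y < 8 * (2 * h + 1)) :
    y ∉ blowUp h {0, 1, 3, 4} + blowUp h {0, 1, 2, 5} := by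
  intro hy
  obtain ⟨u, hu, v, hv, rfl⟩ := Set.mem_add.1 hy
  rcases hu with ⟨a, ha, i, hi, rfl⟩ | hu
  · rcases hv with ⟨b, hb, j, hj, rfl⟩ | hv
    · simp only [Set.mem_insert_iff, Set.mem_singleton_iff] at ha hb
      rcases ha with rfl | rfl | rfl | rfl <;> rcases hb with rfl | rfl | rfl | rfl <;> omega
    · have := Set.mem_Ici.1 hv
      omega
  · have := Set.mem_Ici.1 hu
    omega

/-- Cutting a cofinite additive basis `A` of order two and resuming later creates exactly `s`
missing sums. -/
theorem ncard_compl_truncate_add_self {A : Set ℕ} {k N : ℕ} (s : ℕ) (h0 : 0 ∈ A)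
    (hk : Set.Ici k ⊆ A) (hA : A + A = Set.univ) (hN : 2 * k ≤ N) :
    ((A ∩ Set.Iic N ∪ Set.Ici (2 * N + 1 + s)) +
      (A ∩ Set.Iic N ∪ Set.Ici (2 * N + 1 + s)))ᶜ.ncard = s := by
  have : ((A ∩ Set.Iic N ∪ Set.Ici (2 * N + 1 + s)) +
      (A ∩ Set.Iic N ∪ Set.Ici (2 * N + 1 + s)))ᶜ = Finset.Ico (2 * N + 1) (2 * N + 1 + s) := by
    ext y
    rw [Set.mem_compl_iff, Finset.mem_coe, Finset.mem_Ico, Set.mem_add]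
    constructor
    · intro hy
      by_contra hcon
      refine hy ?_
      rcases le_or_gt (2 * N + 1 + s) y with h1 | h1
      · exact ⟨0, Or.inl ⟨h0, Nat.zero_le _⟩, y, Or.inr h1, by simp⟩
      · have hy2 : y ≤ 2 * N := by omega
        rcases le_or_gt y N with h2 | h2
        · obtain ⟨a, ha, b, hb, hab⟩ := Set.mem_add.1 (hA ▸ Set.mem_univ y : y ∈ A + A)
          exact ⟨a, Or.inl ⟨ha, Set.mem_Iic.2 (by omega)⟩, b,
            Or.inl ⟨hb, Set.mem_Iic.2 (by omega)⟩, hab⟩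
        · rcases le_or_gt k (y - N) with h3 | h3
          · exact ⟨N, Or.inl ⟨hk (Set.mem_Ici.2 (by omega)), Set.mem_Iic.2 le_rfl⟩, y - N,
              Or.inl ⟨hk h3, Set.mem_Iic.2 (by omega)⟩, by omega⟩
          · exact ⟨k, Or.inl ⟨hk (Set.mem_Ici.2 le_rfl), Set.mem_Iic.2 (by omega)⟩, y - k,
              Or.inl ⟨hk (Set.mem_Ici.2 (by omega)), Set.mem_Iic.2 (by omega)⟩, by omega⟩
    · rintro ⟨h1, h2⟩ ⟨a, ha, b, hb, hab⟩
      rcases ha with ⟨-, ha⟩ | ha <;> rcases hb with ⟨-, hb⟩ | hb <;>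
        simp only [Set.mem_Iic, Set.mem_Ici] at ha hb <;> omega
  rw [this, Set.ncard_coe_finset, Nat.card_Ico]
  omega

/-- Adding a full tail to `B` at a suitable place leaves exactly `e` missing elements in `A + B`. -/
theorem exists_ncard_compl_add_union_Ici {A B : Set ℕ} {e : ℕ} (h0 : 0 ∈ A)
    (he : e < (A + B)ᶜ.ncard) :
    ∃ y, (A + (B ∪ Set.Ici y))ᶜ.ncard = e := by
  classical
  -- The tail starts at the missing element of index `e`, counted from 0: since `0 ∈ A`, everything
  -- from there on is filled, nothing below changes, and exactly `e` gaps remain.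
  refine ⟨Nat.nth (· ∈ (A + B)ᶜ) e, ?_⟩
  have hc : Nat.count (· ∈ (A + B)ᶜ) (Nat.nth (· ∈ (A + B)ᶜ) e) = e := by
    refine Nat.count_nth fun hf => ?_
    rwa [← Set.ncard_eq_toFinset_card _ hf]
  set y := Nat.nth (· ∈ (A + B)ᶜ) e
  have : (A + (B ∪ Set.Ici y))ᶜ = ((Finset.range y).filter (· ∈ (A + B)ᶜ) : Finset ℕ) := by
    ext x
    simp only [Set.add_union, Set.compl_union, Set.mem_inter_iff, Finset.coe_filter,
      Finset.mem_range, Set.mem_ofPred_eq]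
    rw [and_comm]
    refine and_congr_left fun _ => ?_
    rw [Set.mem_compl_iff, not_iff_comm, not_lt]
    constructor
    · intro h
      exact Set.mem_add.2 ⟨0, h0, x, h, by simp⟩
    · intro h
      obtain ⟨a, -, b, hb, rfl⟩ := Set.mem_add.1 h
      exact le_add_left (Set.mem_Ici.1 hb)
  rw [this, Set.ncard_coe_finset, ← Nat.count_eq_card_filter_range, hc]

/-- Every pair `(s, e)` is the pair of numbers of missing sums and of missing cross sums of two
cofinite sets of natural numbers containing `0`. -/
theorem exists_cofinite_missing (s e : ℕ) : ∃ (A B : Set ℕ) (k : ℕ), 0 ∈ A ∧ 0 ∈ B ∧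
    Set.Ici k ⊆ A ∧ Set.Ici k ⊆ B ∧ (A + A)ᶜ.ncard + (B + B)ᶜ.ncard = s ∧
    (A + B)ᶜ.ncard = e := by
  set m := 2 * e + 1 with hm
  set A := blowUp e {0, 1, 3, 4} with hA
  set B := blowUp e {0, 1, 2, 5} with hB
  have hA0 : 0 ∈ A := Or.inl ⟨0, by simp, 0, by omega, by simp⟩
  have hB0 : 0 ∈ B := Or.inl ⟨0, by simp, 0, by omega, by simp⟩
  have hAA : A + A = Set.univ := blowUp_add_self (by simp) fun q hq => by
    interval_cases q <;> simp
  have hBB : B + B = Set.univ := blowUp_add_self (by simp) fun q hq => by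
    interval_cases q <;> simp
  have hAk : Set.Ici (8 * m) ⊆ A := Set.subset_union_right
  have hBk : Set.Ici (8 * m) ⊆ B := Set.subset_union_right
  set N := 16 * m
  -- Truncation produces the `s` missing sums, all from `A'`. It only shrinks `A`, so the block of
  -- `2 * e + 1` missing cross sums survives, and a tail added to `B` then cuts it down to `e` gaps
  -- without spoiling `B + B`.
  set A' := A ∩ Set.Iic N ∪ Set.Ici (2 * N + 1 + s) with hA'
  have hA'A : A' ⊆ A := Set.union_subset Set.inter_subset_left fun x hx =>
    hAk (Set.mem_Ici.2 (by have := Set.mem_Ici.1 hx; omega))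
  have hA'0 : 0 ∈ A' := Or.inl ⟨hA0, Nat.zero_le _⟩
  have hfin : (A' + B)ᶜ.Finite := (Set.finite_Iio (8 * m)).subset fun x hx => by
    by_contra hcon
    exact hx (Set.mem_add.2 ⟨0, hA'0, x, hBk (not_lt.1 (Set.mem_Iio.not.1 hcon)), by simp⟩)
  have hcard : e < (A' + B)ᶜ.ncard := by
    have hsub : ((Finset.Ico (7 * m) (8 * m) : Finset ℕ) : Set ℕ) ⊆ (A' + B)ᶜ := fun x hx => by
      rw [Finset.mem_coe, Finset.mem_Ico] at hx
      exact fun h => notMem_blowUp_add hx.1 hx.2 (Set.add_subset_add_right hA'A h)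
    have := Set.ncard_le_ncard hsub hfin
    rw [Set.ncard_coe_finset, Nat.card_Ico] at this
    omega
  obtain ⟨y, hy⟩ := exists_ncard_compl_add_union_Ici hA'0 hcard
  refine ⟨A', B ∪ Set.Ici y, 2 * N + 1 + s, hA'0, Or.inl hB0, Set.subset_union_right,
    fun x hx => Or.inl (hBk (Set.mem_Ici.2 (by have := Set.mem_Ici.1 hx; omega))), ?_, hy⟩
  have h1 : (B ∪ Set.Ici y) + (B ∪ Set.Ici y) = Set.univ :=
    Set.eq_univ_of_univ_subset (hBB ▸ Set.add_subset_add Set.subset_union_left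
      Set.subset_union_left)
  rw [h1, ncard_compl_truncate_add_self s hA0 hAk hAA (by omega)]
  simp

/-! ### Probabilities for uniformly random subsets -/

open Classical in
/-- The probability that a uniformly random subset of `V` satisfies `p`. -/
noncomputable def subsetProb {α : Type*} (V : Finset α) (p : Finset α → Prop) : ℝ :=
  (V.powerset.filter p).card / 2 ^ V.card

section SubsetProb
variable {α : Type*} {V : Finset α} {p q r : Finset α → Prop}

theorem subsetProb_nonneg : 0 ≤ subsetProb V p := by
  unfold subsetProb; positivity

theorem subsetProb_mono (h : ∀ S ⊆ V, p S → q S) : subsetProb V p ≤ subsetProb V q := by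
  classical
  unfold subsetProb
  refine div_le_div_of_nonneg_right (Nat.cast_le.2 (Finset.card_le_card fun S hS => ?_))
    (by positivity)
  rw [Finset.mem_filter, Finset.mem_powerset] at hS ⊢
  exact ⟨hS.1, h S hS.1 hS.2⟩

theorem subsetProb_congr (h : ∀ S ⊆ V, (p S ↔ q S)) : subsetProb V p = subsetProb V q :=
  le_antisymm (subsetProb_mono fun S hS => (h S hS).1) (subsetProb_mono fun S hS => (h S hS).2)

theorem subsetProb_true : subsetProb V (fun _ => True) = 1 := by
  simp [subsetProb]

theorem subsetProb_le_one : subsetProb V p ≤ 1 :=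
  (subsetProb_mono fun _ _ _ => trivial).trans_eq subsetProb_true

theorem subsetProb_or_le :
    subsetProb V (fun S => p S ∨ q S) ≤ subsetProb V p + subsetProb V q := by
  classical
  unfold subsetProb
  rw [← add_div, ← Nat.cast_add]
  refine div_le_div_of_nonneg_right (Nat.cast_le.2 ((Finset.card_le_card fun S hS => ?_).trans
    (Finset.card_union_le _ _))) (by positivity)
  have hS' := (@Finset.mem_filter _ _ (fun _ => Classical.propDecidable _) _ _).1 hS
  rw [Finset.mem_union, Finset.mem_filter, Finset.mem_filter]
  tauto

theorem subsetProb_exists_le {ι : Type*} (I : Finset ι) (f : ι → Finset α → Prop) :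
    subsetProb V (fun S => ∃ i ∈ I, f i S) ≤ ∑ i ∈ I, subsetProb V (f i) := by
  classical
  induction I using Finset.induction_on with
  | empty => simp [subsetProb]
  | insert a I ha ih =>
    rw [Finset.sum_insert ha]
    simp only [Finset.mem_insert, exists_eq_or_imp]
    exact subsetProb_or_le.trans (by gcongr)

theorem subsetProb_add_not : subsetProb V p + subsetProb V (fun S => ¬ p S) = 1 := by
  classical
  unfold subsetProb
  rw [← add_div, ← Nat.cast_add, Finset.card_filter_add_card_filter_not, Finset.card_powerset]
  simp

theorem subsetProb_le_add (h : ∀ S ⊆ V, p S → q S ∨ r S) :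
    subsetProb V p ≤ subsetProb V q + subsetProb V r :=
  (subsetProb_mono h).trans subsetProb_or_le

/-- Two events that agree outside a third one have nearly the same probability. -/
theorem abs_subsetProb_sub_le (h : ∀ S ⊆ V, ¬ r S → (p S ↔ q S)) :
    |subsetProb V p - subsetProb V q| ≤ subsetProb V r := by
  have h1 : subsetProb V p ≤ subsetProb V q + subsetProb V r := subsetProb_le_add fun S hS hp => by
    by_cases hr : r S
    · exact Or.inr hr
    · exact Or.inl ((h S hS hr).1 hp)
  have h2 : subsetProb V q ≤ subsetProb V p + subsetProb V r := subsetProb_le_add fun S hS hp => by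
    by_cases hr : r S
    · exact Or.inr hr
    · exact Or.inl ((h S hS hr).2 hp)
  rw [abs_le]
  constructor <;> linarith

/-- The traces of a random subset on two disjoint sets are independent. -/
theorem subsetProb_union [DecidableEq α] {W W' : Finset α} (hd : Disjoint W W') :
    subsetProb (W ∪ W') (fun S => p (S ∩ W) ∧ q (S ∩ W')) =
      subsetProb W p * subsetProb W' q := by
  classical
  unfold subsetProb
  rw [div_mul_div_comm, ← pow_add, Finset.card_union_of_disjoint hd, ← Nat.cast_mul,
    ← Finset.card_product]
  congr 2
  have hdw : ∀ x, x ∈ W → x ∉ W' := fun x hx => Finset.disjoint_left.1 hd hx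
  refine Finset.card_nbij' (fun S => (S ∩ W, S ∩ W')) (fun T => T.1 ∪ T.2) ?_ ?_ ?_ ?_
  · intro S hS
    simp only [Finset.coe_filter, Finset.mem_powerset, Set.mem_ofPred_eq] at hS
    simp [hS.2]
  · rintro ⟨T, T'⟩ hT
    simp only [Finset.coe_product, Finset.coe_filter, Finset.mem_powerset, Set.mem_prod,
      Set.mem_ofPred_eq] at hT
    obtain ⟨⟨h1, h2⟩, h3, h4⟩ := hT
    have e1 : (T ∪ T') ∩ W = T := by
      ext x
      have := hdw x
      have := @h1 x
      have := @h3 x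
      simp only [Finset.mem_inter, Finset.mem_union]
      tauto
    have e2 : (T ∪ T') ∩ W' = T' := by
      ext x
      have := hdw x
      have := @h1 x
      have := @h3 x
      simp only [Finset.mem_inter, Finset.mem_union]
      tauto
    simp only [Finset.coe_filter, Finset.mem_powerset, Set.mem_ofPred_eq, e1, e2]
    exact ⟨Finset.union_subset_union h1 h3, h2, h4⟩
  · intro S hS
    simp only [Finset.coe_filter, Finset.mem_powerset, Set.mem_ofPred_eq] at hS
    change S ∩ W ∪ S ∩ W' = S
    rw [← Finset.inter_union_distrib_left]
    exact Finset.inter_eq_left.2 hS.1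
  · rintro ⟨T, T'⟩ hT
    simp only [Finset.coe_product, Finset.coe_filter, Finset.mem_powerset, Set.mem_prod,
      Set.mem_ofPred_eq] at hT
    obtain ⟨⟨h1, h2⟩, h3, h4⟩ := hT
    ext x
    · have := hdw x
      have := @h1 x
      have := @h3 x
      simp only [Finset.mem_inter, Finset.mem_union]
      tauto
    · have := hdw x
      have := @h1 x
      have := @h3 x
      simp only [Finset.mem_inter, Finset.mem_union]
      tauto

theorem subsetProb_not_pair [DecidableEq α] {a b : α} (hab : a ≠ b) :
    subsetProb {a, b} (fun S => ¬ (a ∈ S ∧ b ∈ S)) ≤ 3 / 4 := by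
  classical
  have h : ({a, b} : Finset α).powerset.filter (fun S => ¬ (a ∈ S ∧ b ∈ S)) ⊆
      ({a, b} : Finset α).powerset.erase {a, b} := by
    intro S hS
    rw [Finset.mem_filter] at hS
    refine Finset.mem_erase.2 ⟨?_, hS.1⟩
    rintro rfl
    exact hS.2 (by simp)
  have h' := Finset.card_le_card h
  rw [Finset.card_erase_of_mem (Finset.mem_powerset_self _), Finset.card_powerset,
    Finset.card_pair hab] at h'
  unfold subsetProb
  rw [Finset.card_pair hab, show (3 / 4 : ℝ) = (2 ^ 2 - 1 : ℕ) / 2 ^ 2 by norm_num]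
  refine div_le_div_of_nonneg_right (Nat.cast_le.2 (le_of_eq_of_le ?_ h')) (by positivity)
  congr!

/-- A random subset contains none of a family of disjoint pairs with probability at most
`(3 / 4) ^ r`, where `r` is the size of the family. -/
theorem subsetProb_no_pair_le [DecidableEq α] {ι : Type*} (I : Finset ι) (f g : ι → α)
    (V : Finset α) (hf : ∀ i ∈ I, f i ∈ V) (hg : ∀ i ∈ I, g i ∈ V)
    (hfi : Set.InjOn f I) (hgi : Set.InjOn g I) (hfg : ∀ i ∈ I, ∀ j ∈ I, f i ≠ g j) :
    subsetProb V (fun S => ∀ i ∈ I, ¬ (f i ∈ S ∧ g i ∈ S)) ≤ (3 / 4) ^ I.card := by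
  classical
  induction I using Finset.induction_on generalizing V with
  | empty => simpa using subsetProb_le_one
  | insert a I ha ih =>
    simp only [Finset.mem_insert, forall_eq_or_imp, Finset.coe_insert] at hf hg hfi hgi hfg
    set W : Finset α := {f a, g a} with hW
    have hWV : W ⊆ V := by
      intro x hx
      rw [hW, Finset.mem_insert, Finset.mem_singleton] at hx
      rcases hx with rfl | rfl
      exacts [hf.1, hg.1]
    have hfa : ∀ i ∈ I, f i ∉ W ∧ g i ∉ W := by
      intro i hi
      have h1 : f i ≠ f a := fun h => ha (hfi (Set.mem_insert_of_mem _ hi) (Set.mem_insert _ _) h ▸ hi)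
      have h2 : g i ≠ g a := fun h => ha (hgi (Set.mem_insert_of_mem _ hi) (Set.mem_insert _ _) h ▸ hi)
      simp only [hW, Finset.mem_insert, Finset.mem_singleton, not_or]
      exact ⟨⟨h1, (hfg.2 i hi).1⟩, (hfg.1.2 i hi).symm, h2⟩
    -- The remaining pairs avoid `W`, so their event depends on the trace on `V \ W` only and is
    -- independent of the first pair.
    have hI := ih (V \ W) (fun i hi => Finset.mem_sdiff.2 ⟨hf.2 i hi, (hfa i hi).1⟩)
      (fun i hi => Finset.mem_sdiff.2 ⟨hg.2 i hi, (hfa i hi).2⟩)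
      (hfi.mono (Set.subset_insert _ _)) (hgi.mono (Set.subset_insert _ _))
      (fun i hi j hj => (hfg.2 i hi).2 j hj)
    have key := subsetProb_union (p := fun S => ¬ (f a ∈ S ∧ g a ∈ S))
      (q := fun S => ∀ i ∈ I, ¬ (f i ∈ S ∧ g i ∈ S))
      (Finset.disjoint_sdiff : Disjoint W (V \ W))
    rw [Finset.union_sdiff_of_subset hWV] at key
    calc _ ≤ _ := subsetProb_mono fun S hS h => ?_
      _ = _ := key
      _ ≤ 3 / 4 * (3 / 4) ^ I.card :=
        mul_le_mul (subsetProb_not_pair hfg.1.1) hI subsetProb_nonneg (by norm_num)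
      _ = _ := by rw [Finset.card_insert_of_notMem ha, pow_succ']
    refine ⟨fun h' => h a (Finset.mem_insert_self _ _)
      ⟨(Finset.mem_inter.1 h'.1).1, (Finset.mem_inter.1 h'.2).1⟩, fun i hi h' =>
      h i (Finset.mem_insert_of_mem hi)
      ⟨(Finset.mem_inter.1 h'.1).1, (Finset.mem_inter.1 h'.2).1⟩⟩

end SubsetProb

/-! ### Sums and differences in the middle are rarely missing -/

theorem three_quarters_pow_le {r z : ℕ} (h : z ≤ 2 * r) : (3 / 4 : ℝ) ^ r ≤ (7 / 8) ^ z :=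
  calc (3 / 4 : ℝ) ^ r ≤ ((7 / 8) ^ 2) ^ r := by gcongr; norm_num
    _ = (7 / 8) ^ (2 * r) := (pow_mul _ _ _).symm
    _ ≤ (7 / 8) ^ z := pow_le_pow_of_le_one (by norm_num) (by norm_num) h

/-- At least half of the elements of `{0, …, N - 1}` can be chosen with no two differing by `m`. -/
theorem exists_no_diff_subset_range (N : ℕ) {m : ℕ} (hm : 0 < m) :
    ∃ I ⊆ Finset.range N, N ≤ 2 * I.card ∧ ∀ i ∈ I, ∀ j ∈ I, i ≠ j + m := by
  -- Keep every other block of length `m`; shifting down by `m` injects the discarded blocks into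
  -- the kept ones.
  refine ⟨(Finset.range N).filter fun a => a / m % 2 = 0, Finset.filter_subset _ _, ?_, ?_⟩
  · have h := Finset.card_filter_add_card_filter_not (s := Finset.range N) fun a => a / m % 2 = 0
    rw [Finset.card_range] at h
    have : ((Finset.range N).filter fun a => ¬ a / m % 2 = 0).card ≤
        ((Finset.range N).filter fun a => a / m % 2 = 0).card := by
      have hge : ∀ a ∈ (Finset.range N).filter fun a => ¬ a / m % 2 = 0, m ≤ a := fun a ha => by
        by_contra hcon
        exact (Finset.mem_filter.1 ha).2 (by rw [Nat.div_eq_of_lt (not_le.1 hcon)])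
      refine Finset.card_le_card_of_injOn (fun a => a - m) (fun a ha => ?_) fun a ha b hb hab => ?_
      · have h1 := hge a ha
        have h2 := Finset.mem_filter.1 ha
        have h3 := Finset.mem_range.1 h2.1
        refine Finset.mem_coe.2 (Finset.mem_filter.2
          ⟨Finset.mem_range.2 (show a - m < N by omega), ?_⟩)
        have h4 : a / m = (a - m) / m + 1 := by
          rw [← Nat.add_div_right _ hm, Nat.sub_add_cancel h1]
        change (a - m) / m % 2 = 0
        omega
      · have h1 := hge a ha
        have h2 := hge b hb
        change a - m = b - m at hab
        omega
    omega
  · rintro i hi j hj rfl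
    have h1 := (Finset.mem_filter.1 hi).2
    have h2 := (Finset.mem_filter.1 hj).2
    rw [Nat.add_div_right _ hm] at h1
    omega

section Middle
variable {n k K y : ℕ}

/-- The disjoint pairs `{k + i, y - k - i}` all have sum `y`; a possible midpoint, paired with
itself, is left out. -/
theorem subsetProb_low_sum_missing_le (hk : 2 * k ≤ y) (hy : y ≤ n) :
    subsetProb (Finset.Icc 0 (n : ℤ)) (fun S => (y : ℤ) ∉
      S ∩ Finset.Icc (k : ℤ) (n - k) + S ∩ Finset.Icc (k : ℤ) (n - k)) ≤ (7 / 8) ^ (y - 2 * k) := by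
  refine le_trans (subsetProb_mono fun S _ h i hi hS => h ?_)
    ((subsetProb_no_pair_le (Finset.range ((y - 2 * k + 1) / 2)) (fun i => (k + i : ℤ))
    (fun i => (y - k - i : ℤ)) _ ?_ ?_ ?_ ?_ ?_).trans ?_)
  · rw [Finset.mem_range] at hi
    refine Finset.mem_add.2 ⟨_, Finset.mem_inter.2 ⟨hS.1, ?_⟩, _,
      Finset.mem_inter.2 ⟨hS.2, ?_⟩, by ring⟩ <;> rw [Finset.mem_Icc] <;> omega
  · intro i hi
    rw [Finset.mem_range] at hi
    rw [Finset.mem_Icc]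
    omega
  · intro i hi
    rw [Finset.mem_range] at hi
    rw [Finset.mem_Icc]
    omega
  · intro i _ j _ h
    simp only at h
    omega
  · intro i _ j _ h
    simp only at h
    omega
  · intro i hi j hj h
    rw [Finset.mem_range] at hi hj
    omega
  · rw [Finset.card_range]
    exact three_quarters_pow_le (by omega)

theorem subsetProb_high_sum_missing_le (hk : 2 * k ≤ y) (hy : y ≤ n) :
    subsetProb (Finset.Icc 0 (n : ℤ)) (fun S => (2 * n - y : ℤ) ∉
      S ∩ Finset.Icc (k : ℤ) (n - k) + S ∩ Finset.Icc (k : ℤ) (n - k)) ≤ (7 / 8) ^ (y - 2 * k) := by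
  refine le_trans (subsetProb_mono fun S _ h i hi hS => h ?_)
    ((subsetProb_no_pair_le (Finset.range ((y - 2 * k + 1) / 2)) (fun i => (n - k - i : ℤ))
    (fun i => (n - (y - k - i) : ℤ)) _ ?_ ?_ ?_ ?_ ?_).trans ?_)
  · rw [Finset.mem_range] at hi
    refine Finset.mem_add.2 ⟨_, Finset.mem_inter.2 ⟨hS.1, ?_⟩, _,
      Finset.mem_inter.2 ⟨hS.2, ?_⟩, by ring⟩ <;> rw [Finset.mem_Icc] <;> omega
  · intro i hi
    rw [Finset.mem_range] at hi
    rw [Finset.mem_Icc]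
    omega
  · intro i hi
    rw [Finset.mem_range] at hi
    rw [Finset.mem_Icc]
    omega
  · intro i _ j _ h
    simp only at h
    omega
  · intro i _ j _ h
    simp only at h
    omega
  · intro i hi j hj h
    rw [Finset.mem_range] at hi hj
    omega
  · rw [Finset.card_range]
    exact three_quarters_pow_le (by omega)

/-- The pairs with difference `n - y` overlap in chains, so only a disjoint subfamily, at least half
of them, is used. -/
theorem subsetProb_diff_missing_le (hk : 2 * k ≤ y) (hy : y < n) :
    subsetProb (Finset.Icc 0 (n : ℤ)) (fun S => (n - y : ℤ) ∉
      S ∩ Finset.Icc (k : ℤ) (n - k) - S ∩ Finset.Icc (k : ℤ) (n - k)) ≤ (7 / 8) ^ (y - 2 * k) := by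
  obtain ⟨I, hIN, hcard, hI⟩ := exists_no_diff_subset_range (y - 2 * k + 1) (m := n - y) (by omega)
  refine le_trans (subsetProb_mono fun S _ h i hi hS => h ?_)
    ((subsetProb_no_pair_le I (fun i => (k + i : ℤ))
    (fun i => (k + i + (n - y) : ℤ)) _ ?_ ?_ ?_ ?_ ?_).trans ?_)
  · have := Finset.mem_range.1 (hIN hi)
    refine Finset.mem_sub.2 ⟨_, Finset.mem_inter.2 ⟨hS.2, ?_⟩, _,
      Finset.mem_inter.2 ⟨hS.1, ?_⟩, by ring⟩ <;> rw [Finset.mem_Icc] <;> omega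
  · intro i hi
    have := Finset.mem_range.1 (hIN hi)
    rw [Finset.mem_Icc]
    omega
  · intro i hi
    have := Finset.mem_range.1 (hIN hi)
    rw [Finset.mem_Icc]
    omega
  · intro i _ j _ h
    simp only at h
    omega
  · intro i _ j _ h
    simp only at h
    omega
  · intro i hi j hj h
    have := hI i hi j hj
    omega
  · exact three_quarters_pow_le (by omega)

/-- All sums and differences of `S` at distance at least `K` from the extremes are present. -/
def MiddleFull (n K : ℕ) (S : Finset ℤ) : Prop :=
  (∀ x : ℤ, K ≤ x → x ≤ 2 * n - K → x ∈ S + S) ∧ ∀ m : ℤ, 0 ≤ m → m ≤ n - K → m ∈ S - S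

theorem MiddleFull.mono {S T : Finset ℤ} (h : MiddleFull n K S) (hST : S ⊆ T) :
    MiddleFull n K T :=
  ⟨fun x h1 h2 => Finset.add_subset_add hST hST (h.1 x h1 h2),
    fun m h1 h2 => Finset.sub_subset_sub hST hST (h.2 m h1 h2)⟩

theorem middleFull_of_forall {T : Finset ℤ} (hK : K ≤ n)
    (h : ∀ y ∈ Finset.Icc K n, (y : ℤ) ∈ T + T ∧ (2 * n - y : ℤ) ∈ T + T ∧
      (y < n → (n - y : ℤ) ∈ T - T)) : MiddleFull n K T := by
  constructor
  · intro x h1 h2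
    rcases le_total x n with hx | hx
    · lift x to ℕ using by omega
      exact (h x (Finset.mem_Icc.2 ⟨by omega, by omega⟩)).1
    · obtain ⟨y, hy⟩ : ∃ y : ℕ, (y : ℤ) = 2 * n - x := ⟨(2 * n - x).toNat, by omega⟩
      have := (h y (Finset.mem_Icc.2 ⟨by omega, by omega⟩)).2.1
      rwa [hy, sub_sub_cancel] at this
  · intro m h1 h2
    rcases h1.eq_or_lt with rfl | h1
    -- Difference 0 only needs `T` nonempty, which follows from the representation of `n` as a sum.
    · obtain ⟨a, ha, -⟩ := Finset.mem_add.1 (h n (Finset.mem_Icc.2 ⟨hK, le_rfl⟩)).1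
      exact Finset.mem_sub.2 ⟨a, ha, a, ha, sub_self a⟩
    · obtain ⟨y, hy⟩ : ∃ y : ℕ, (y : ℤ) = n - m := ⟨(n - m).toNat, by omega⟩
      have := (h y (Finset.mem_Icc.2 ⟨by omega, by omega⟩)).2.2 (by omega)
      rwa [hy, sub_sub_cancel] at this

theorem sum_Icc_seven_eighths_pow_le (hk : 2 * k ≤ K) :
    ∑ y ∈ Finset.Icc K n, (7 / 8 : ℝ) ^ (y - 2 * k) ≤ 8 * (7 / 8) ^ (K - 2 * k) := by
  have : Finset.Icc K n = Finset.Ico K (n + 1) := by ext; simp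
  rw [this, Finset.sum_Ico_eq_sum_range]
  have h : ∀ i, (7 / 8 : ℝ) ^ (K + i - 2 * k) = (7 / 8) ^ (K - 2 * k) * (7 / 8) ^ i := fun i => by
    rw [← pow_add]
    congr 1
    omega
  simp_rw [h]
  rw [← Finset.mul_sum, mul_comm (8 : ℝ), geom_sum_eq (by norm_num)]
  gcongr
  have : (0 : ℝ) ≤ (7 / 8) ^ (n + 1 - K) := by positivity
  rw [div_le_iff_of_neg (by norm_num)]
  linarith

/-- The sums and differences in the middle are all present with high probability, even when only
the elements of `S` at distance at least `k` from the extremes are used. -/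
theorem subsetProb_not_middleFull_le (hk : 2 * k ≤ K) (hK : K ≤ n) :
    subsetProb (Finset.Icc 0 (n : ℤ))
      (fun S => ¬ MiddleFull n K (S ∩ Finset.Icc (k : ℤ) (n - k))) ≤
      24 * (7 / 8) ^ (K - 2 * k) := by
  set T : Finset ℤ → Finset ℤ := fun S => S ∩ Finset.Icc (k : ℤ) (n - k) with hT
  calc _ ≤ subsetProb (Finset.Icc 0 (n : ℤ)) (fun S => ∃ y ∈ Finset.Icc K n,
        ((y : ℤ) ∉ T S + T S ∨ (2 * n - y : ℤ) ∉ T S + T S) ∨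
          (y < n ∧ (n - y : ℤ) ∉ T S - T S)) := by
        refine subsetProb_mono fun S _ h => ?_
        by_contra! hcon
        exact h (middleFull_of_forall hK fun y hy =>
          ⟨(hcon y hy).1.1, (hcon y hy).1.2, (hcon y hy).2⟩)
    -- Union bound with three bad events per distance `y`; the geometric series contributes a factor
    -- 8, hence 24.
    _ ≤ ∑ y ∈ Finset.Icc K n, 3 * (7 / 8 : ℝ) ^ (y - 2 * k) := by
        refine (subsetProb_exists_le _ _).trans (Finset.sum_le_sum fun y hy => ?_)
        rw [Finset.mem_Icc] at hy
        have h3 : subsetProb (Finset.Icc 0 (n : ℤ)) (fun S => y < n ∧ (n - y : ℤ) ∉ T S - T S) ≤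
            (7 / 8) ^ (y - 2 * k) := by
          by_cases hyn : y < n
          · exact (subsetProb_mono fun S _ h => h.2).trans
              (subsetProb_diff_missing_le (by omega) hyn)
          · simp only [hyn, false_and, subsetProb, Finset.filter_false]
            simp only [Finset.card_empty, Nat.cast_zero, zero_div]
            positivity
        have h1 := subsetProb_low_sum_missing_le (n := n) (k := k) (y := y) (by omega) hy.2
        have h2 := subsetProb_high_sum_missing_le (n := n) (k := k) (y := y) (by omega) hy.2
        refine subsetProb_or_le.trans ((add_le_add subsetProb_or_le h3).trans ?_)
        linarith
    _ ≤ _ := by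
        rw [← Finset.mul_sum]
        have := sum_Icc_seven_eighths_pow_le (n := n) hk
        linarith

end Middle

/-! ### Reduction of the missing counts to the fringe -/

/-- The numbers of missing sums and differences at distance less than `K` from the extremes. -/
def fringeCount (n K : ℕ) (S : Finset ℤ) : ℕ × ℕ :=
  (((Finset.range K).filter fun x : ℕ => (x : ℤ) ∉ S + S).card +
    ((Finset.range K).filter fun x : ℕ => (2 * n - x : ℤ) ∉ S + S).card,
    2 * ((Finset.range K).filter fun x : ℕ => (n - x : ℤ) ∉ S - S).card)

/-- The elements of `{0, …, n}` at distance less than `K` from the ends. -/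
noncomputable def fringe (n K : ℕ) : Finset ℤ := Finset.Icc 0 (n : ℤ) \ Finset.Icc (K : ℤ) (n - K)

section Fringe
variable {n K : ℕ} {S : Finset ℤ}

theorem card_compl_add_eq (hS : S ⊆ Finset.Icc 0 (n : ℤ)) (hK : K ≤ n) (h : MiddleFull n K S) :
    (fringeCount n K S).1 + (S + S).card = 2 * n + 1 := by
  have hsub : S + S ⊆ Finset.Icc 0 (2 * n : ℤ) := by
    intro x hx
    obtain ⟨a, ha, b, hb, rfl⟩ := Finset.mem_add.1 hx
    have h1 := Finset.mem_Icc.1 (hS ha)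
    have h2 := Finset.mem_Icc.1 (hS hb)
    exact Finset.mem_Icc.2 ⟨by omega, by omega⟩
  have hcard := Finset.card_sdiff_add_card_eq_card hsub
  rw [Int.card_Icc] at hcard
  have heq : Finset.Icc 0 (2 * n : ℤ) \ (S + S) =
      ((Finset.range K).filter fun x : ℕ => (x : ℤ) ∉ S + S).image (fun x : ℕ => (x : ℤ)) ∪
      ((Finset.range K).filter fun x : ℕ => (2 * n - x : ℤ) ∉ S + S).image
        (fun x : ℕ => (2 * n - x : ℤ)) := by
    ext x
    simp only [Finset.mem_sdiff, Finset.mem_Icc, Finset.mem_union, Finset.mem_image,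
      Finset.mem_filter, Finset.mem_range]
    constructor
    · rintro ⟨⟨h1, h2⟩, h3⟩
      by_cases hx : x < K
      · exact Or.inl ⟨x.toNat, ⟨by omega, by rwa [Int.toNat_of_nonneg h1]⟩, by omega⟩
      · have hx2 : 2 * n - K < x := by
          by_contra hcon
          exact h3 (h.1 x (by omega) (by omega))
        refine Or.inr ⟨(2 * n - x).toNat, ⟨by omega, ?_⟩, by omega⟩
        rwa [Int.toNat_of_nonneg (by omega), sub_sub_cancel]
    · rintro (⟨y, ⟨h1, h2⟩, rfl⟩ | ⟨y, ⟨h1, h2⟩, rfl⟩)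
      · exact ⟨by omega, h2⟩
      · exact ⟨by omega, h2⟩
  rw [heq, Finset.card_union_of_disjoint, Finset.card_image_of_injective,
    Finset.card_image_of_injective] at hcard
  · unfold fringeCount
    omega
  · intro a b hab
    simp only at hab
    omega
  · exact Nat.cast_injective
  · rw [Finset.disjoint_left]
    intro x hx hx'
    simp only [Finset.mem_image, Finset.mem_filter, Finset.mem_range] at hx hx'
    omega

/-- `S - S` is symmetric and 0 is not missing, so missing differences come in pairs `±m` with `m`
positive; this is the source of the factor 2 in `fringeCount`. -/
theorem card_compl_sub_eq (hS : S ⊆ Finset.Icc 0 (n : ℤ)) (hK : K ≤ n) (h : MiddleFull n K S) :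
    (fringeCount n K S).2 + (S - S).card = 2 * n + 1 := by
  have hsub : S - S ⊆ Finset.Icc (-n : ℤ) n := by
    intro x hx
    obtain ⟨a, ha, b, hb, rfl⟩ := Finset.mem_sub.1 hx
    have h1 := Finset.mem_Icc.1 (hS ha)
    have h2 := Finset.mem_Icc.1 (hS hb)
    exact Finset.mem_Icc.2 ⟨by omega, by omega⟩
  have hneg : ∀ x : ℤ, x ∈ S - S ↔ -x ∈ S - S := by
    intro x
    simp only [Finset.mem_sub]
    constructor
    · rintro ⟨a, ha, b, hb, rfl⟩
      exact ⟨b, hb, a, ha, by ring⟩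
    · rintro ⟨a, ha, b, hb, hab⟩
      exact ⟨b, hb, a, ha, by omega⟩
  have hcard := Finset.card_sdiff_add_card_eq_card hsub
  rw [Int.card_Icc] at hcard
  have heq : Finset.Icc (-n : ℤ) n \ (S - S) =
      ((Finset.range K).filter fun x : ℕ => (n - x : ℤ) ∉ S - S).image
        (fun x : ℕ => (n - x : ℤ)) ∪
      ((Finset.range K).filter fun x : ℕ => (n - x : ℤ) ∉ S - S).image
        (fun x : ℕ => -(n - x : ℤ)) := by
    ext x
    simp only [Finset.mem_sdiff, Finset.mem_Icc, Finset.mem_union, Finset.mem_image,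
      Finset.mem_filter, Finset.mem_range]
    constructor
    · rintro ⟨⟨h1, h2⟩, h3⟩
      rcases le_total 0 x with hx | hx
      · have hx2 : n - K < x := by
          by_contra hcon
          exact h3 (h.2 x hx (by omega))
        refine Or.inl ⟨(n - x).toNat, ⟨by omega, ?_⟩, by omega⟩
        rwa [Int.toNat_of_nonneg (by omega), sub_sub_cancel]
      · rw [hneg] at h3
        have hx2 : n - K < -x := by
          by_contra hcon
          exact h3 (h.2 (-x) (by omega) (by omega))
        refine Or.inr ⟨(n - -x).toNat, ⟨by omega, ?_⟩, by omega⟩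
        rwa [Int.toNat_of_nonneg (by omega), sub_sub_cancel]
    · rintro (⟨y, ⟨h1, h2⟩, rfl⟩ | ⟨y, ⟨h1, h2⟩, rfl⟩)
      · exact ⟨by omega, h2⟩
      · exact ⟨by omega, (hneg _).not.1 h2⟩
  rw [heq, Finset.card_union_of_disjoint, Finset.card_image_of_injective,
    Finset.card_image_of_injective] at hcard
  · unfold fringeCount
    omega
  · intro a b hab
    simp only at hab
    omega
  · intro a b hab
    simp only at hab
    omega
  · rw [Finset.disjoint_left]
    intro x hx hx'
    simp only [Finset.mem_image, Finset.mem_filter, Finset.mem_range] at hx hx'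
    omega

theorem missingCount_eq_fringeCount (hS : S ⊆ Finset.Icc 0 (n : ℤ)) (hK : K ≤ n)
    (h : MiddleFull n K S) : missingCount n S = fringeCount n K S := by
  have h1 := card_compl_add_eq hS hK h
  have h2 := card_compl_sub_eq hS hK h
  have h3 := missingCount_fst_add (n := n) (S := S) hS
  have h4 := missingCount_snd_add (n := n) (S := S) hS
  ext <;> omega

/-- A sum below `K` uses only elements below `K`, a sum above `2 * n - K` only elements above `n -
K`, and a difference above `n - K` one of each. -/
theorem fringeCount_inter_fringe (hS : S ⊆ Finset.Icc 0 (n : ℤ)) :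
    fringeCount n K (S ∩ fringe n K) = fringeCount n K S := by
  have hmem : ∀ a ∈ S, (a < K ∨ n - K < a) → a ∈ S ∩ fringe n K := by
    intro a ha h
    refine Finset.mem_inter.2 ⟨ha, Finset.mem_sdiff.2 ⟨hS ha, ?_⟩⟩
    rw [Finset.mem_Icc]
    omega
  have h0 : ∀ a ∈ S, 0 ≤ a ∧ a ≤ n := fun a ha => Finset.mem_Icc.1 (hS ha)
  have hsub : S ∩ fringe n K ⊆ S := Finset.inter_subset_left
  have h1 : ∀ x ∈ Finset.range K, ((x : ℤ) ∉ S ∩ fringe n K + S ∩ fringe n K ↔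
      (x : ℤ) ∉ S + S) := by
    intro x hx
    rw [Finset.mem_range] at hx
    refine not_congr ⟨fun h => Finset.add_subset_add hsub hsub h, fun h => ?_⟩
    obtain ⟨a, ha, b, hb, hab⟩ := Finset.mem_add.1 h
    have := h0 a ha
    have := h0 b hb
    exact Finset.mem_add.2 ⟨a, hmem a ha (by omega), b, hmem b hb (by omega), hab⟩
  have h2 : ∀ x ∈ Finset.range K, ((2 * n - x : ℤ) ∉ S ∩ fringe n K + S ∩ fringe n K ↔
      (2 * n - x : ℤ) ∉ S + S) := by
    intro x hx
    rw [Finset.mem_range] at hx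
    refine not_congr ⟨fun h => Finset.add_subset_add hsub hsub h, fun h => ?_⟩
    obtain ⟨a, ha, b, hb, hab⟩ := Finset.mem_add.1 h
    have := h0 a ha
    have := h0 b hb
    exact Finset.mem_add.2 ⟨a, hmem a ha (by omega), b, hmem b hb (by omega), hab⟩
  have h3 : ∀ x ∈ Finset.range K, ((n - x : ℤ) ∉ S ∩ fringe n K - S ∩ fringe n K ↔
      (n - x : ℤ) ∉ S - S) := by
    intro x hx
    rw [Finset.mem_range] at hx
    refine not_congr ⟨fun h => Finset.sub_subset_sub hsub hsub h, fun h => ?_⟩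
    obtain ⟨a, ha, b, hb, hab⟩ := Finset.mem_sub.1 h
    have := h0 a ha
    have := h0 b hb
    exact Finset.mem_sub.2 ⟨a, hmem a ha (by omega), b, hmem b hb (by omega), hab⟩
  unfold fringeCount
  rw [Finset.filter_congr h1, Finset.filter_congr h2, Finset.filter_congr h3]

open Classical in
theorem card_filter_notMem_eq_ncard_compl {C : Set ℕ} (hC : Set.Ici K ⊆ C) :
    ((Finset.range K).filter (· ∉ C)).card = Cᶜ.ncard := by
  rw [← Set.ncard_coe_finset]
  congr 1
  ext x
  simp only [Finset.coe_filter, Finset.mem_range, Set.mem_ofPred_eq, Set.mem_compl_iff,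
    and_iff_right_iff_imp]
  exact fun h => not_le.1 fun h' => h (hC h')

/-- With `b = n - b'`, the difference `b - a` is `n - (a + b')`: differences near `n` are governed
by the cross sums `A + B`. -/
theorem fringeCount_eq_ncard {A B : Set ℕ} (hS : S ⊆ Finset.Icc 0 (n : ℤ))
    (hA : ∀ x < K, ((x : ℤ) ∈ S ↔ x ∈ A)) (hB : ∀ x < K, ((n - x : ℤ) ∈ S ↔ x ∈ B))
    (hAA : Set.Ici K ⊆ A + A) (hBB : Set.Ici K ⊆ B + B) (hAB : Set.Ici K ⊆ A + B) :
    fringeCount n K S = ((A + A)ᶜ.ncard + (B + B)ᶜ.ncard, 2 * (A + B)ᶜ.ncard) := by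
  classical
  have h0 : ∀ a ∈ S, 0 ≤ a ∧ a ≤ n := fun a ha => Finset.mem_Icc.1 (hS ha)
  have h1 : ∀ x ∈ Finset.range K, ((x : ℤ) ∉ S + S ↔ x ∉ A + A) := by
    intro x hx
    rw [Finset.mem_range] at hx
    rw [Finset.mem_add, Set.mem_add]
    refine not_congr ⟨?_, ?_⟩
    · rintro ⟨a, ha, b, hb, hab⟩
      have := h0 a ha
      have := h0 b hb
      lift a to ℕ using by omega
      lift b to ℕ using by omega
      exact ⟨a, (hA a (by omega)).1 ha, b, (hA b (by omega)).1 hb, by omega⟩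
    · rintro ⟨a, ha, b, hb, hab⟩
      exact ⟨a, (hA a (by omega)).2 ha, b, (hA b (by omega)).2 hb, by omega⟩
  have hsub : ∀ a : ℤ, a ≤ n → ∃ a' : ℕ, a = n - a' := fun a ha => ⟨(n - a).toNat, by omega⟩
  have h2 : ∀ x ∈ Finset.range K, ((2 * n - x : ℤ) ∉ S + S ↔ x ∉ B + B) := by
    intro x hx
    rw [Finset.mem_range] at hx
    rw [Finset.mem_add, Set.mem_add]
    refine not_congr ⟨?_, ?_⟩
    · rintro ⟨a, ha, b, hb, hab⟩
      obtain ⟨a, rfl⟩ := hsub a (h0 a ha).2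
      obtain ⟨b, rfl⟩ := hsub b (h0 b hb).2
      exact ⟨a, (hB a (by omega)).1 ha, b, (hB b (by omega)).1 hb, by omega⟩
    · rintro ⟨a, ha, b, hb, hab⟩
      exact ⟨n - a, (hB a (by omega)).2 ha, n - b, (hB b (by omega)).2 hb, by omega⟩
  have h3 : ∀ x ∈ Finset.range K, ((n - x : ℤ) ∉ S - S ↔ x ∉ A + B) := by
    intro x hx
    rw [Finset.mem_range] at hx
    rw [Finset.mem_sub, Set.mem_add]
    refine not_congr ⟨?_, ?_⟩
    · rintro ⟨a, ha, b, hb, hab⟩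
      have := h0 b hb
      obtain ⟨a, rfl⟩ := hsub a (h0 a ha).2
      lift b to ℕ using this.1
      exact ⟨b, (hA b (by omega)).1 hb, a, (hB a (by omega)).1 ha, by omega⟩
    · rintro ⟨a, ha, b, hb, hab⟩
      exact ⟨n - b, (hB b (by omega)).2 hb, a, (hA a (by omega)).2 ha, by omega⟩
  unfold fringeCount
  rw [Finset.filter_congr h1, Finset.filter_congr h2, Finset.filter_congr h3,
    card_filter_notMem_eq_ncard_compl hAA, card_filter_notMem_eq_ncard_compl hBB,
    card_filter_notMem_eq_ncard_compl hAB]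

theorem fringe_union_Icc : fringe n K ∪ Finset.Icc (K : ℤ) (n - K) = Finset.Icc 0 (n : ℤ) := by
  refine Finset.sdiff_union_of_subset fun x hx => ?_
  rw [Finset.mem_Icc] at hx ⊢
  omega

theorem disjoint_fringe_Icc : Disjoint (fringe n K) (Finset.Icc (K : ℤ) (n - K)) :=
  Finset.sdiff_disjoint

theorem card_fringe (hK : 2 * K ≤ n) : (fringe n K).card = 2 * K := by
  have h := Finset.card_union_of_disjoint (disjoint_fringe_Icc (n := n) (K := K))
  rw [fringe_union_Icc, Int.card_Icc, Int.card_Icc] at h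
  omega

end Fringe

/-! ### A positive lower bound for attaining a given pair -/

theorem subsetProb_eq {α : Type*} {V F : Finset α} (hF : F ⊆ V) :
    subsetProb V (fun S => S = F) = 1 / 2 ^ V.card := by
  unfold subsetProb
  rw [Finset.card_eq_one.2 ⟨F, ?_⟩, Nat.cast_one]
  ext S
  rw [Finset.mem_singleton, @Finset.mem_filter _ _ (fun _ => Classical.propDecidable _) _ _,
    Finset.mem_powerset]
  exact ⟨fun h => h.2, fun h => ⟨h ▸ hF, h⟩⟩

theorem exists_pow_lt_of_pos {ε : ℝ} (hε : 0 < ε) : ∃ j : ℕ, 24 * (7 / 8 : ℝ) ^ j < ε := by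
  obtain ⟨j, hj⟩ := exists_pow_lt_of_lt_one (show 0 < ε / 24 by positivity)
    (show (7 / 8 : ℝ) < 1 by norm_num)
  exact ⟨j, by linarith⟩

/-- Every pair `(s, 2 * e)` is attained with probability bounded away from zero. -/
theorem exists_pos_le_subsetProb_missingCount_eq (s e : ℕ) : ∃ c : ℝ, 0 < c ∧ ∃ n₀ : ℕ, ∀ n ≥ n₀,
    c ≤ subsetProb (Finset.Icc 0 (n : ℤ)) (fun S => missingCount n S = (s, 2 * e)) := by
  classical
  obtain ⟨A, B, k, hA0, hB0, hAk, hBk, hs, he⟩ := exists_cofinite_missing s e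
  obtain ⟨j, hj⟩ := exists_pow_lt_of_pos (show (0 : ℝ) < 1 / 2 by norm_num)
  set K := 2 * k + j with hK
  -- The first factor is the probability of the prescribed fringe, the second bounds that of a full
  -- middle; `j` was chosen to make the latter fail with probability below `1 / 2`.
  refine ⟨1 / 2 ^ (2 * K) * (1 / 2), by positivity, 2 * K, fun n hn => ?_⟩
  have hkK : ∀ x, K ≤ x → k ≤ x := fun x hx => by omega
  have hAA : Set.Ici K ⊆ A + A := fun x hx =>
    Set.mem_add.2 ⟨0, hA0, x, hAk (hkK x hx), zero_add x⟩
  have hBB : Set.Ici K ⊆ B + B := fun x hx =>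
    Set.mem_add.2 ⟨0, hB0, x, hBk (hkK x hx), zero_add x⟩
  have hAB : Set.Ici K ⊆ A + B := fun x hx =>
    Set.mem_add.2 ⟨0, hA0, x, hBk (hkK x hx), zero_add x⟩
  set F : Finset ℤ := (fringe n K).filter fun x =>
    (x < K ∧ x.toNat ∈ A) ∨ (n - K < x ∧ (n - x).toNat ∈ B) with hF
  set q : Finset ℤ → Prop := fun M => MiddleFull n K (F ∪ M) with hq
  have hind := fun p : Finset ℤ → Prop =>
    subsetProb_union (p := p) (q := q) (disjoint_fringe_Icc (n := n) (K := K))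
  simp only [fringe_union_Icc] at hind
  have h1 : subsetProb (fringe n K) (fun S => S = F) = 1 / 2 ^ (2 * K) := by
    rw [subsetProb_eq (Finset.filter_subset _ _), card_fringe hn]
  have h2 : 1 / 2 ≤ subsetProb (Finset.Icc (K : ℤ) (n - K)) q := by
    have h3 := hind fun _ => True
    rw [subsetProb_true, one_mul] at h3
    rw [← h3]
    have h4 := subsetProb_not_middleFull_le (n := n) (k := k) (K := K) (by omega) (by omega)
    have h5 := subsetProb_add_not (V := Finset.Icc 0 (n : ℤ))
      (p := fun S => MiddleFull n K (S ∩ Finset.Icc (k : ℤ) (n - k)))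
    rw [hK, Nat.add_sub_cancel_left, ← hK] at h4
    refine le_trans (b := subsetProb (Finset.Icc 0 (n : ℤ))
      (fun S => MiddleFull n K (S ∩ Finset.Icc (k : ℤ) (n - k)))) (by linarith) ?_
    -- Since `A` and `B` contain everything from `k` on, `F` contains every position at distance
    -- between `k` and `K` from the ends. So elements of `S` there are not lost when the fringe is
    -- replaced by `F`.
    refine subsetProb_mono fun S hS h => ⟨trivial, h.mono fun x hx => ?_⟩
    obtain ⟨hxS, hxk⟩ := Finset.mem_inter.1 hx
    rw [Finset.mem_Icc] at hxk
    rw [Finset.mem_union, Finset.mem_inter, Finset.mem_Icc, hF, Finset.mem_filter, fringe,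
      Finset.mem_sdiff, Finset.mem_Icc, Finset.mem_Icc]
    by_cases hxK : (K : ℤ) ≤ x ∧ x ≤ n - K
    · exact Or.inr ⟨hxS, hxK⟩
    · refine Or.inl ⟨⟨Finset.mem_Icc.1 (hS hxS), hxK⟩, ?_⟩
      rcases lt_or_ge x K with hx1 | hx1
      · exact Or.inl ⟨hx1, hAk (Set.mem_Ici.2 (by omega))⟩
      · exact Or.inr ⟨by omega, hBk (Set.mem_Ici.2 (by omega))⟩
  calc _ ≤ subsetProb (fringe n K) (fun S => S = F) *
        subsetProb (Finset.Icc (K : ℤ) (n - K)) q := by rw [h1]; gcongr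
    _ = _ := (hind _).symm
    _ ≤ _ := subsetProb_mono fun S hS h => ?_
  have hfull : MiddleFull n K S := by
    have := h.2
    rw [hq, ← h.1, ← Finset.inter_union_distrib_left, fringe_union_Icc] at this
    exact this.mono Finset.inter_subset_left
  have hmem : ∀ x : ℤ, (0 ≤ x ∧ x < K ∨ n - K < x ∧ x ≤ n) → (x ∈ S ↔ x ∈ F) := by
    intro x hx
    rw [← h.1, Finset.mem_inter, fringe, Finset.mem_sdiff, Finset.mem_Icc, Finset.mem_Icc]
    refine ⟨fun h => ⟨h, by omega⟩, fun h => h.1⟩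
  rw [missingCount_eq_fringeCount hS (by omega) hfull,
    fringeCount_eq_ncard (A := A) (B := B) hS ?_ ?_ hAA hBB hAB, hs, he]
  · intro x hx
    rw [hmem x (by omega), hF, Finset.mem_filter, fringe, Finset.mem_sdiff, Finset.mem_Icc,
      Finset.mem_Icc, Int.toNat_natCast]
    constructor
    · rintro ⟨-, h | h⟩
      · exact h.2
      · omega
    · exact fun h => ⟨by omega, Or.inl ⟨by omega, h⟩⟩
  · intro x hx
    rw [hmem (n - x) (by omega), hF, Finset.mem_filter, fringe, Finset.mem_sdiff, Finset.mem_Icc,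
      Finset.mem_Icc, sub_sub_cancel, Int.toNat_natCast]
    constructor
    · rintro ⟨-, h | h⟩
      · omega
      · exact h.2
    · exact fun h => ⟨by omega, Or.inr ⟨by omega, h⟩⟩

/-! ### Central limit theorem for the unconditioned size -/

section UniformOn
variable {Ω : Type*} [MeasurableSpace Ω] [MeasurableSingletonClass Ω]

theorem integral_uniformOn_finset {E : Type*} [NormedAddCommGroup E] [NormedSpace ℝ E]
    [CompleteSpace E] (s : Finset Ω) (f : Ω → E) :
    ∫ x, f x ∂uniformOn (s : Set Ω) = (s.card : ℝ)⁻¹ • ∑ x ∈ s, f x := by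
  have hint : IntegrableOn f s Measure.count := by
    have : IsFiniteMeasure (Measure.count.restrict (s : Set Ω)) :=
      isFiniteMeasure_restrict.2 (by simp)
    have h := IntegrableOn.finset (μ := Measure.count.restrict (s : Set Ω)) (s := s) (f := f)
    rwa [IntegrableOn, Measure.restrict_restrict s.measurableSet, Set.inter_self] at h
  rw [uniformOn, ProbabilityTheory.cond, integral_smul_measure, setIntegral_finset s hint]
  simp

end UniformOn

theorem intervalSubsets_eq (n : ℕ) :
    intervalSubsets n = ((Finset.Icc 0 (n : ℤ)).powerset : Set (Finset ℤ)) := by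
  ext S
  rw [Finset.mem_coe, Finset.mem_powerset]
  rfl

theorem uniformOn_intervalSubsets_real (n : ℕ) (p : Finset ℤ → Prop) :
    (uniformOn (intervalSubsets n)).real {S | p S} = subsetProb (Finset.Icc 0 (n : ℤ)) p := by
  classical
  rw [intervalSubsets_eq, measureReal_def, ← uniformOn_inter_self (Finset.finite_toSet _)]
  have : ((Finset.Icc 0 (n : ℤ)).powerset : Set (Finset ℤ)) ∩ {S | p S} =
      ((Finset.Icc 0 (n : ℤ)).powerset.filter p : Finset (Finset ℤ)) := by
    ext S
    rw [Set.mem_inter_iff, Finset.mem_coe, Finset.mem_coe, Finset.mem_filter]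
    rfl
  rw [this, uniformOn_apply_finset, Finset.inter_eq_right.2 (Finset.filter_subset _ _),
    Finset.card_powerset, subsetProb]
  simp

instance (n : ℕ) : IsProbabilityMeasure (uniformOn (intervalSubsets n)) := by
  rw [intervalSubsets_eq]
  exact isProbabilityMeasure_uniformOn (Finset.finite_toSet _) ⟨∅, by simp⟩

/-- The centered and rescaled size of a subset of `{0, …, n}`. -/
noncomputable def scaledCard (n : ℕ) (S : Finset ℤ) : ℝ :=
  (√(n + 1 : ℕ))⁻¹ * (2 * S.card - (n + 1))

theorem measurable_scaledCard (n : ℕ) : Measurable (scaledCard n) := measurable_of_countable _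

/-- The law of a fair sign. -/
noncomputable def fairSign : Measure ℝ := uniformOn (({-1, 1} : Finset ℝ) : Set ℝ)

instance : IsProbabilityMeasure fairSign :=
  isProbabilityMeasure_uniformOn (Finset.finite_toSet _) ⟨1, by simp⟩

theorem integral_fairSign {E : Type*} [NormedAddCommGroup E] [NormedSpace ℝ E]
    [CompleteSpace E] (f : ℝ → E) : ∫ x, f x ∂fairSign = (2 : ℝ)⁻¹ • (f (-1) + f 1) := by
  have h : (-1 : ℝ) ≠ 1 := by norm_num
  rw [fairSign, integral_uniformOn_finset, Finset.sum_pair h, Finset.card_pair h, Nat.cast_ofNat]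

/-- `2 * S.card - (n + 1)` is a sum of `n + 1` fair signs; the binomial expansion over subsets
factorises its characteristic function directly. -/
theorem charFun_map_scaledCard (n : ℕ) (t : ℝ) :
    charFun ((uniformOn (intervalSubsets n)).map (scaledCard n)) t =
      charFun fairSign ((√(n + 1 : ℕ))⁻¹ * t) ^ (n + 1) := by
  rw [charFun_apply_real, charFun_apply_real, integral_fairSign,
    integral_map (measurable_scaledCard n).aemeasurable (by fun_prop), intervalSubsets_eq,
    integral_uniformOn_finset, Finset.card_powerset, Int.card_Icc]
  set u : ℝ := (√(n + 1 : ℕ))⁻¹ * t with hu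
  have hN : ((n : ℤ) + 1 - 0).toNat = n + 1 := by omega
  have h := Finset.sum_pow_mul_eq_add_pow (Complex.exp (u * (1 : ℝ) * Complex.I))
    (Complex.exp (u * (-1 : ℝ) * Complex.I)) (Finset.Icc 0 (n : ℤ))
  rw [Int.card_Icc, hN] at h
  rw [smul_pow, add_comm (Complex.exp _), ← h, hN]
  congr 1
  · simp
  · refine Finset.sum_congr rfl fun S hS => ?_
    have hS' : S.card ≤ n + 1 := by
      have := Finset.card_le_card (Finset.mem_powerset.1 hS)
      rwa [Int.card_Icc, hN] at this
    rw [← Complex.exp_nat_mul, ← Complex.exp_nat_mul, ← Complex.exp_add, Nat.cast_sub hS', hu,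
      scaledCard]
    congr 1
    push_cast
    ring

/-- The law of the rescaled size of a uniformly random subset of `{0, …, n}`. -/
noncomputable def scaledCardLaw (n : ℕ) : ProbabilityMeasure ℝ :=
  ⟨(uniformOn (intervalSubsets n)).map (scaledCard n),
    Measure.isProbabilityMeasure_map (measurable_scaledCard n).aemeasurable⟩

theorem tendsto_scaledCardLaw :
    Tendsto scaledCardLaw atTop
      (𝓝 (⟨gaussianReal 0 1, inferInstance⟩ : ProbabilityMeasure ℝ)) := by
  refine ProbabilityMeasure.tendsto_iff_tendsto_charFun.2 fun t => ?_
  simp only [scaledCardLaw, ProbabilityMeasure.coe_mk, charFun_map_scaledCard, charFun_gaussianReal]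
  have h0 : ∫ x, id x ∂fairSign = 0 := by rw [integral_fairSign]; simp
  have h1 : ∫ x, (id ^ 2 : ℝ → ℝ) x ∂fairSign = 1 := by rw [integral_fairSign]; norm_num
  have h := (tendsto_charFun_inv_sqrt_mul_pow aemeasurable_id h0 h1 t).comp (tendsto_add_atTop_nat 1)
  rw [Measure.map_id] at h
  refine (h.congr fun n => rfl).trans_eq ?_
  congr 2
  simp
  ring

theorem tendsto_subsetProb_scaledCard (x : ℝ) :
    Tendsto (fun n : ℕ => subsetProb (Finset.Icc 0 (n : ℤ)) fun S => scaledCard n S < x) atTop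
      (𝓝 (cdf (gaussianReal 0 1) x)) := by
  have hatom : gaussianReal 0 1 {x} = 0 := by
    have := nullSingletonClass_gaussianReal (μ := 0) (v := 1) one_ne_zero
    exact measure_singleton x
  have h := ProbabilityMeasure.tendsto_measure_of_null_frontier_of_tendsto' tendsto_scaledCardLaw
    (E := Set.Iio x) (by rw [frontier_Iio]; exact hatom)
  have hcdf : cdf (gaussianReal 0 1) x = (gaussianReal 0 1 (Set.Iio x)).toReal := by
    rw [cdf_eq_real, measureReal_def, ← Set.Iio_union_right]
    refine congrArg _ (le_antisymm ((measure_union_le _ _).trans_eq ?_)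
      (measure_mono Set.subset_union_left))
    rw [hatom, add_zero]
  rw [hcdf]
  refine ((ENNReal.tendsto_toReal (measure_ne_top (gaussianReal 0 1) _)).comp h).congr fun n => ?_
  rw [Function.comp_apply, scaledCardLaw, ProbabilityMeasure.coe_mk,
    Measure.map_apply (measurable_scaledCard n) measurableSet_Iio,
    ← uniformOn_intervalSubsets_real]
  rfl

theorem continuous_cdf_gaussianReal : Continuous (cdf (gaussianReal 0 1)) := by
  refine continuous_iff_continuousAt.2 fun x => ?_
  rw [(monotone_cdf _).continuousAt_iff_leftLim_eq_rightLim, StieltjesFunction.rightLim_eq]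
  have hatom : (cdf (gaussianReal 0 1)).measure {x} = 0 := by
    have := nullSingletonClass_gaussianReal (μ := 0) (v := 1) one_ne_zero
    rw [measure_cdf]
    exact measure_singleton x
  rw [StieltjesFunction.measure_singleton, ENNReal.ofReal_eq_zero, sub_nonpos] at hatom
  exact le_antisymm ((monotone_cdf _).leftLim_le le_rfl) hatom

/-- Normal limit of the size of a random subset, with a bounded perturbation of the threshold. -/
theorem tendsto_subsetProb_card_lt (t r : ℝ) :
    Tendsto (fun n : ℕ => subsetProb (Finset.Icc 0 (n : ℤ)) fun S =>
      (S.card : ℝ) < (n + t * √n) / 2 + r) atTop (𝓝 (cdf (gaussianReal 0 1) t)) := by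
  have hx : Tendsto (fun n : ℕ => (√(n + 1 : ℕ))⁻¹ * (t * √n + 2 * r - 1)) atTop (𝓝 t) := by
    have h1 : Tendsto (fun n : ℕ => √((n : ℝ) / (n + 1))) atTop (𝓝 1) := by
      have h := (Real.continuous_sqrt.tendsto 1).comp (tendsto_natCast_div_add_atTop (1 : ℝ))
      rwa [Real.sqrt_one] at h
    have h2 : Tendsto (fun n : ℕ => (√(n + 1 : ℕ))⁻¹) atTop (𝓝 0) :=
      tendsto_inv_atTop_zero.comp (Real.tendsto_sqrt_atTop.comp
        (tendsto_natCast_atTop_atTop.comp (tendsto_add_atTop_nat 1)))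
    have h3 := (h1.const_mul t).add (h2.mul_const (2 * r - 1))
    rw [mul_one, zero_mul, add_zero] at h3
    refine h3.congr fun n => ?_
    rw [Real.sqrt_div (Nat.cast_nonneg n), Nat.cast_succ, div_eq_mul_inv]
    ring
  have heq : ∀ n : ℕ, (subsetProb (Finset.Icc 0 (n : ℤ)) fun S =>
      (S.card : ℝ) < (n + t * √n) / 2 + r) = subsetProb (Finset.Icc 0 (n : ℤ)) fun S =>
      scaledCard n S < (√(n + 1 : ℕ))⁻¹ * (t * √n + 2 * r - 1) := fun n => by
    refine subsetProb_congr fun S _ => ?_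
    rw [scaledCard, mul_lt_mul_iff_right₀ (by positivity)]
    constructor <;> intro h <;> linarith
  simp_rw [heq]
  -- The threshold moves with `n`, so it is compared with a fixed `y` near `t`, using monotonicity
  -- and continuity of the normal distribution function.
  refine tendsto_order.2 ⟨fun a ha => ?_, fun a ha => ?_⟩
  · obtain ⟨y, hy, hya⟩ : ∃ y < t, a < cdf (gaussianReal 0 1) y :=
      ((continuous_cdf_gaussianReal.tendsto t).eventually_const_lt ha
        |>.filter_mono nhdsWithin_le_nhds |>.and self_mem_nhdsWithin : ∀ᶠ y in 𝓝[<] t, _ ∧ _).exists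
        |>.imp fun y hy => ⟨hy.2, hy.1⟩
    filter_upwards [(tendsto_subsetProb_scaledCard y).eventually_const_lt hya,
      hx.eventually_const_lt hy] with n h1 h2
    exact h1.trans_le (subsetProb_mono fun S _ h => h.trans h2)
  · obtain ⟨y, hy, hya⟩ : ∃ y > t, cdf (gaussianReal 0 1) y < a :=
      ((continuous_cdf_gaussianReal.tendsto t).eventually_lt_const ha
        |>.filter_mono nhdsWithin_le_nhds |>.and self_mem_nhdsWithin : ∀ᶠ y in 𝓝[>] t, _ ∧ _).exists
        |>.imp fun y hy => ⟨hy.2, hy.1⟩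
    filter_upwards [(tendsto_subsetProb_scaledCard y).eventually_lt_const hya,
      hx.eventually_lt_const hy] with n h1 h2
    exact (subsetProb_mono fun S _ h => h.trans h2).trans_lt h1

/-! ### Asymptotic independence and conditioning -/

theorem subsetProb_and_add_and_not {α : Type*} {V : Finset α} {p q : Finset α → Prop} :
    subsetProb V (fun S => p S ∧ q S) + subsetProb V (fun S => p S ∧ ¬ q S) = subsetProb V p := by
  classical
  unfold subsetProb
  rw [← add_div, ← Nat.cast_add,
    ← Finset.card_filter_add_card_filter_not (s := V.powerset.filter p) q, Finset.filter_filter,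
    Finset.filter_filter]
  congr!

theorem abs_subsetProb_le_one {α : Type*} {V : Finset α} {p : Finset α → Prop} :
    |subsetProb V p| ≤ 1 := by
  rw [abs_of_nonneg subsetProb_nonneg]
  exact subsetProb_le_one

/-- Up to a small error, the missing counts and the size of a random subset are independent. -/
theorem abs_subsetProb_and_sub_mul_le (Λ : Set (ℕ × ℕ)) (c : ℝ) {n K : ℕ} (hK : 2 * K ≤ n) :
    |subsetProb (Finset.Icc 0 (n : ℤ)) (fun S => missingCount n S ∈ Λ ∧ (S.card : ℝ) < c) -
      subsetProb (Finset.Icc 0 (n : ℤ)) (fun S => missingCount n S ∈ Λ) *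
        subsetProb (Finset.Icc 0 (n : ℤ)) (fun S => (S.card : ℝ) < c)| ≤
      48 * (7 / 8) ^ K +
        2 * subsetProb (Finset.Icc 0 (n : ℤ)) (fun S => (S.card : ℝ) < c + 2 * K ∧ ¬ S.card < c) := by
  set V := Finset.Icc 0 (n : ℤ) with hV
  set W' := Finset.Icc (K : ℤ) (n - K)
  set p : Finset ℤ → Prop := fun A => fringeCount n K A ∈ Λ with hp
  set q : Finset ℤ → Prop := fun M => (M.card : ℝ) < c with hq
  have hind : ∀ p q : Finset ℤ → Prop,
      subsetProb V (fun S => p (S ∩ fringe n K) ∧ q (S ∩ W')) =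
        subsetProb (fringe n K) p * subsetProb W' q := fun p q => by
    rw [hV, ← fringe_union_Icc (n := n) (K := K), subsetProb_union disjoint_fringe_Icc]
  have hb : subsetProb V (fun S => ¬ MiddleFull n K S) ≤ 24 * (7 / 8) ^ K := by
    have h := subsetProb_not_middleFull_le (n := n) (k := 0) (K := K) (by omega) (by omega)
    rw [Nat.cast_zero, sub_zero] at h
    refine (subsetProb_mono fun S hS hf => ?_).trans h
    rwa [Finset.inter_eq_left.2 hS]
  have hcount : ∀ S ⊆ V, MiddleFull n K S →
      (missingCount n S ∈ Λ ↔ p (S ∩ fringe n K)) := fun S hS hf => by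
    rw [hp, missingCount_eq_fringeCount hS (by omega) hf]
    simp only [fringeCount_inter_fringe hS]
  -- The fringe holds at most `2 * K` elements, so `S` and its middle part can lie on different
  -- sides of `c` only if `c ≤ S.card < c + 2 * K`.
  have hcard : ∀ S ⊆ V, ¬ ((S.card : ℝ) < c + 2 * K ∧ ¬ S.card < c) →
      ((S.card : ℝ) < c ↔ q (S ∩ W')) := fun S hS hr => by
    have h1 : S.card = (S ∩ fringe n K).card + (S ∩ W').card := by
      rw [← Finset.card_union_of_disjoint (disjoint_fringe_Icc.mono Finset.inter_subset_right
        Finset.inter_subset_right), ← Finset.inter_union_distrib_left, fringe_union_Icc,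
        Finset.inter_eq_left.2 hS]
    have h2 : (S ∩ fringe n K).card ≤ 2 * K :=
      (Finset.card_le_card Finset.inter_subset_right).trans_eq (card_fringe hK)
    have h3 : (S.card : ℝ) = (S ∩ fringe n K).card + (S ∩ W').card := by exact_mod_cast h1
    have h4 : ((S ∩ fringe n K).card : ℝ) ≤ 2 * K := by exact_mod_cast h2
    have h5 : (0 : ℝ) ≤ (S ∩ fringe n K).card := Nat.cast_nonneg _
    constructor
    · intro h
      change ((S ∩ W').card : ℝ) < c
      linarith
    · intro h
      change ((S ∩ W').card : ℝ) < c at h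
      by_contra hcon
      exact hr ⟨by linarith, hcon⟩
  set b := subsetProb V (fun S => ¬ MiddleFull n K S)
  set r := subsetProb V (fun S => (S.card : ℝ) < c + 2 * K ∧ ¬ S.card < c)
  have h1 : |subsetProb V (fun S => missingCount n S ∈ Λ ∧ (S.card : ℝ) < c) -
      subsetProb (fringe n K) p * subsetProb W' q| ≤ b + r := by
    rw [← hind]
    refine (abs_subsetProb_sub_le fun S hS h => ?_).trans subsetProb_or_le
    rw [not_or, not_not] at h
    rw [hcount S hS h.1, hcard S hS h.2]
  have h2 : |subsetProb V (fun S => missingCount n S ∈ Λ) - subsetProb (fringe n K) p| ≤ b := by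
    have h := hind p fun _ => True
    rw [subsetProb_true, mul_one] at h
    rw [← h]
    refine abs_subsetProb_sub_le fun S hS h => ?_
    rw [not_not] at h
    rw [hcount S hS h, and_true]
  have h3 : |subsetProb V (fun S => (S.card : ℝ) < c) - subsetProb W' q| ≤ r := by
    have h := hind (fun _ => True) q
    rw [subsetProb_true, one_mul] at h
    rw [← h]
    refine abs_subsetProb_sub_le fun S hS h => ?_
    rw [hcard S hS h, true_and]
  set y := subsetProb V (fun S => missingCount n S ∈ Λ)
  set z := subsetProb V (fun S => (S.card : ℝ) < c)
  have hz1 : |z| ≤ 1 := abs_subsetProb_le_one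
  have hy1 : |subsetProb (fringe n K) p| ≤ 1 := abs_subsetProb_le_one
  -- With fringe probability `p'` and middle probability `q'`, `y * z - p' * q' = (y - p') * z + p'
  -- * (z - q')`, so the total error is `(b + r) + b + r`.
  have h4 : |(y - subsetProb (fringe n K) p) * z| ≤ b := by
    rw [abs_mul]
    exact (mul_le_of_le_one_right (abs_nonneg _) hz1).trans h2
  have h5 : |subsetProb (fringe n K) p * (z - subsetProb W' q)| ≤ r := by
    rw [abs_mul]
    exact (mul_le_of_le_one_left (abs_nonneg _) hy1).trans h3
  rw [abs_le] at h1 h4 h5 ⊢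
  constructor <;> nlinarith

theorem tendsto_subsetProb_and_sub_mul (Λ : Set (ℕ × ℕ)) (t : ℝ) :
    Tendsto (fun n : ℕ => subsetProb (Finset.Icc 0 (n : ℤ))
        (fun S => missingCount n S ∈ Λ ∧ (S.card : ℝ) < (n + t * √n) / 2) -
      subsetProb (Finset.Icc 0 (n : ℤ)) (fun S => missingCount n S ∈ Λ) *
        subsetProb (Finset.Icc 0 (n : ℤ)) (fun S => (S.card : ℝ) < (n + t * √n) / 2))
      atTop (𝓝 0) := by
  rw [Metric.tendsto_atTop']
  intro ε hε
  obtain ⟨K, hK⟩ := exists_pow_lt_of_pos (show 0 < ε / 4 by positivity)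
  have h0 := tendsto_subsetProb_card_lt t 0
  simp only [add_zero] at h0
  -- A window of fixed width `2 * K` has vanishing probability: both of its endpoints lead to the
  -- same normal limit.
  have hr : Tendsto (fun n : ℕ => subsetProb (Finset.Icc 0 (n : ℤ)) (fun S =>
      (S.card : ℝ) < (n + t * √n) / 2 + 2 * K ∧ ¬ S.card < (n + t * √n) / 2)) atTop (𝓝 0) := by
    have h := (tendsto_subsetProb_card_lt t (2 * K)).sub h0
    rw [sub_self] at h
    refine h.congr fun n => ?_
    rw [← subsetProb_and_add_and_not (p := fun S : Finset ℤ =>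
      (S.card : ℝ) < (n + t * √n) / 2 + 2 * K)
      (q := fun S => (S.card : ℝ) < (n + t * √n) / 2), sub_eq_iff_eq_add, add_comm]
    congr 1
    refine subsetProb_congr fun S _ => ⟨fun h => h.2, fun h => ⟨?_, h⟩⟩
    have : (0 : ℝ) ≤ K := Nat.cast_nonneg K
    linarith
  obtain ⟨n₀, hn₀⟩ := eventually_atTop.1 (hr.eventually_lt_const (show 0 < ε / 4 by positivity))
  refine ⟨max n₀ (2 * K), fun n hn => ?_⟩
  rw [Real.dist_eq, sub_zero]
  have h1 := hn₀ n ((le_max_left _ _).trans hn.le)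
  have h2 := abs_subsetProb_and_sub_mul_le Λ ((n + t * √n) / 2) ((le_max_right _ _).trans hn.le)
  linarith

/-- Evenness of `d` enters only here, to bound the denominator below by a constant `c`; the error in
the product formula then stays negligible after division. -/
theorem tendsto_subsetProb_div (Λ : Set (ℕ × ℕ)) (hΛ : ∃ s d : ℕ, (s, d) ∈ Λ ∧ Even d) (t : ℝ) :
    Tendsto (fun n : ℕ => subsetProb (Finset.Icc 0 (n : ℤ))
        (fun S => missingCount n S ∈ Λ ∧ (S.card : ℝ) < (n + t * √n) / 2) /
      subsetProb (Finset.Icc 0 (n : ℤ)) (fun S => missingCount n S ∈ Λ))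
      atTop (𝓝 (cdf (gaussianReal 0 1) t)) := by
  obtain ⟨s, d, hsd, hd⟩ := hΛ
  obtain ⟨e, rfl⟩ := even_iff_exists_two_mul.1 hd
  obtain ⟨c, hc, n₀, hn₀⟩ := exists_pos_le_subsetProb_missingCount_eq s e
  have hpos : ∀ n ≥ n₀, c ≤ subsetProb (Finset.Icc 0 (n : ℤ)) (fun S => missingCount n S ∈ Λ) :=
    fun n hn => (hn₀ n hn).trans (subsetProb_mono fun S _ h => by rw [h]; exact hsd)
  have h0 := tendsto_subsetProb_card_lt t 0
  simp only [add_zero] at h0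
  have h1 := (tendsto_subsetProb_and_sub_mul Λ t).abs.div_const c
  rw [abs_zero, zero_div] at h1
  have h2 : Tendsto (fun n : ℕ => (subsetProb (Finset.Icc 0 (n : ℤ))
        (fun S => missingCount n S ∈ Λ ∧ (S.card : ℝ) < (n + t * √n) / 2) /
      subsetProb (Finset.Icc 0 (n : ℤ)) (fun S => missingCount n S ∈ Λ)) -
      subsetProb (Finset.Icc 0 (n : ℤ)) (fun S => (S.card : ℝ) < (n + t * √n) / 2))
      atTop (𝓝 0) := by
    refine squeeze_zero_norm' ?_ h1
    filter_upwards [eventually_ge_atTop n₀] with n hn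
    have hy := hpos n hn
    rw [Real.norm_eq_abs, div_sub' (hc.trans_le hy).ne', abs_div, abs_of_pos (hc.trans_le hy)]
    gcongr
  have h3 := h2.add h0
  rw [zero_add] at h3
  exact h3.congr fun n => sub_add_cancel _ _

/-- Central limit theorem for the size of a uniform random subset `S n` of `{0, …, n}` conditioned
on `λ_n(S n) ∈ Λ`. -/
theorem mainTheorem8 (Λ : Set (ℕ × ℕ)) (hΛ : ∃ s d : ℕ, (s, d) ∈ Λ ∧ Even d)
    {Ω : ℕ → Type*} [∀ n, MeasurableSpace (Ω n)]
    (P : ∀ n, Measure (Ω n)) [∀ n, IsProbabilityMeasure (P n)]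
    (S : ∀ n, Ω n → Finset ℤ) (hSm : ∀ n, Measurable (S n))
    (hS : ∀ n, (P n).map (S n) = uniformOn (intervalSubsets n)) (t : ℝ) :
    Tendsto
      (fun n : ℕ =>
        (cond (P n) {ω | missingCount n (S n ω) ∈ Λ}).real
          {ω | ((S n ω).card : ℝ) < ((n : ℝ) + t * Real.sqrt n) / 2})
      atTop (𝓝 (cdf (gaussianReal 0 1) t)) := by
  refine (tendsto_subsetProb_div Λ hΛ t).congr fun n => ?_
  have hlaw : ∀ p : Finset ℤ → Prop,
      (P n).real {ω | p (S n ω)} = subsetProb (Finset.Icc 0 (n : ℤ)) p := fun p => by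
    rw [← uniformOn_intervalSubsets_real, ← hS,
      map_measureReal_apply (hSm n) (Set.to_countable _).measurableSet]
    rfl
  have hmeas : MeasurableSet {ω | missingCount n (S n ω) ∈ Λ} :=
    hSm n (Set.to_countable {T | missingCount n T ∈ Λ}).measurableSet
  rw [measureReal_def, cond_apply hmeas, ENNReal.toReal_mul, ENNReal.toReal_inv, ← measureReal_def,
    ← measureReal_def, ← Set.ofPred_and, hlaw fun T => missingCount n T ∈ Λ,
    hlaw fun T => missingCount n T ∈ Λ ∧ (T.card : ℝ) < ((n : ℝ) + t * √n) / 2, div_eq_inv_mul]
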